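/- Let $\boldsymbol a=(a_1,a_2,a_3,a_4)$ and $\boldsymbol b=(b_1,b_2,b_3,b_4)$ be integers with $$\{b_1,b_2\}\le\{a_1,a_2,a_3,a_4\}<\{b_3,b_4\},\qquad a_1+a_2+a_3+a_4=b_1+b_2+b_3+b_4-2 .\qquad(*)$$ Put $$R(t)=\prod_{j=1}^{2}\frac{(t+b_j)(t+b_j+1)\cdots(t+a_j-1)}{(a_j-b_j)!}\cdot\prod_{j=3}^{4}\frac{(b_j-a_j-1)!}{(t+a_j)(t+a_j+1)\cdots(t+b_j-1)},$$ $$G(\boldsymbol a,\boldsymbol b)=-(-1)^{b_1+b_2}\sum_{t=1-\max\{b_1,b_2\}}^{\infty}R'(t)$$ (the sum is over integers $t$ and converges absolutely), and let $\boldsymbol c=(c_{jk})_{1\le j,k\le4}$ be the matrix with $c_{jk}=a_j-b_k$ if $a_j\ge b_k$ and $c_{jk}=b_k-a_j-1$ if $a_j<b_k$. A $4\times4$ matrix $\boldsymbol c$ is called admissible if it arises in this way from some $(\boldsymbol a,\boldsymbol b)$ satisfying $(*)$ and all its entries are positive; since $(\boldsymbol a,\boldsymbol b)$ is determined by $\boldsymbol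 c$ up to adding one integer to all eight parameters, and this does not change $G$, one may put $H(\boldsymbol c):=G(\boldsymbol a,\boldsymbol b)$. Let $$\Pi(\boldsymbol c)=c_{21}!\,c_{31}!\,c_{41}!\,c_{12}!\,c_{32}!\,c_{42}!\,c_{33}!\,c_{44}!\,.$$ Let $\mathfrak G$ be the group of permutations of the $16$ entries of the matrix that is generated by the exchange of lines $j$ and $4$ for $j=1,2,3$, the exchange of columns $3$ and $4$, and $\mathfrak h=(c_{11}\;c_{33})(c_{13}\;c_{31})(c_{22}\;c_{44})(c_{24}\;c_{42})$. Lemma 9. $\mathfrak G$ maps admissible matrices to admissible matrices, and the quantity $H(\boldsymbol c)/\Pi(\boldsymbol c)$ is stable under the action of $\mathfrak G$: for every admissible $\boldsymbol c$ and every $\mathfrak g\in\mathfrak G$, $$\frac{H(\mathfrak g\boldsymbol c)}{\Pi(\mathfrak g\boldsymbol c)}=\frac{H(\boldsymbol c)}{\Pi(\boldsymbol c)} .$$ -/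

import Mathlib

namespace ZetaThree

open Finset
open scoped Asymptotics

/-- The conditions on the integral parameters `(a, b)` (indices `1, …, 4` become `0, …, 3`):
`{b₁, b₂} ≤ {a₁, a₂, a₃, a₄} < {b₃, b₄}` and `a₁ + a₂ + a₃ + a₄ = b₁ + b₂ + b₃ + b₄ - 2`. -/
structure IsParam (a b : Fin 4 → ℤ) : Prop where
  b0_le : ∀ j, b 0 ≤ a j
  b1_le : ∀ j, b 1 ≤ a j
  lt_b2 : ∀ j, a j < b 2
  lt_b3 : ∀ j, a j < b 3
  balanced : a 0 + a 1 + a 2 + a 3 = b 0 + b 1 + b 2 + b 3 - 2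

/-- `(t + b)(t + b + 1) ⋯ (t + a - 1) / (a - b)!`, for `b ≤ a`. -/
noncomputable def upper (a b : ℤ) (t : ℝ) : ℝ :=
  (∏ i ∈ range (a - b).toNat, (t + b + i)) / ((a - b).toNat.factorial : ℝ)

/-- `(b - a - 1)! / ((t + a)(t + a + 1) ⋯ (t + b - 1))`, for `a < b`. -/
noncomputable def lower (a b : ℤ) (t : ℝ) : ℝ :=
  ((b - a - 1).toNat.factorial : ℝ) / ∏ i ∈ range (b - a).toNat, (t + a + i)

/-- The rational function `R(a, b; t) = R₁(t) R₂(t) R₃(t) R₄(t)`. -/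
noncomputable def R (a b : Fin 4 → ℤ) (t : ℝ) : ℝ :=
  upper (a 0) (b 0) t * upper (a 1) (b 1) t * lower (a 2) (b 2) t * lower (a 3) (b 3) t

/-- `G(a, b) = -(-1)^(b₁ + b₂) ∑_{t = t₀}^∞ R'(t)` with `t₀ = 1 - max {b₁, b₂}`. -/
noncomputable def G (a b : Fin 4 → ℤ) : ℝ :=
  -(-1 : ℝ) ^ (b 0 + b 1) *
    ∑' n : ℕ, deriv (R a b) (((1 - max (b 0) (b 1) + n : ℤ)) : ℝ)

/-- The matrix `c`: `c_{jk} = a_j - b_k` if `a_j ≥ b_k`, and `c_{jk} = b_k - a_j - 1`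
if `a_j < b_k`. -/
def cMatrix (a b : Fin 4 → ℤ) : Matrix (Fin 4) (Fin 4) ℕ :=
  Matrix.of fun j k => if b k ≤ a j then (a j - b k).toNat else (b k - a j - 1).toNat

/-- Admissible matrices: those which come from parameters `(a, b)` and have only
positive entries. -/
def Admissible (c : Matrix (Fin 4) (Fin 4) ℕ) : Prop :=
  (∃ a b : Fin 4 → ℤ, IsParam a b ∧ c = cMatrix a b) ∧ ∀ j k, 0 < c j k

/-- The parameters `a` recovered from `c`, normalised by `b₁ = 1`. -/
def aOf (c : Matrix (Fin 4) (Fin 4) ℕ) : Fin 4 → ℤ :=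
  fun j => 1 + c j 0

/-- The parameters `b` recovered from `c`, normalised by `b₁ = 1`. -/
def bOf (c : Matrix (Fin 4) (Fin 4) ℕ) : Fin 4 → ℤ :=
  ![1, 1 + c 0 0 - c 0 1, 2 + c 0 0 + c 0 2, 2 + c 0 0 + c 0 3]

/-- `H(c) = G(a, b)`; the parameters are determined by `c` up to a common integer shift,
on which `G` does not depend: see `H_cMatrix`. -/
noncomputable def H (c : Matrix (Fin 4) (Fin 4) ℕ) : ℝ :=
  G (aOf c) (bOf c)

/-- `Π(c) = c₂₁! c₃₁! c₄₁! c₁₂! c₃₂! c₄₂! c₃₃! c₄₄!`. -/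
def facProd (c : Matrix (Fin 4) (Fin 4) ℕ) : ℕ :=
  (c 1 0).factorial * (c 2 0).factorial * (c 3 0).factorial *
  (c 0 1).factorial * (c 2 1).factorial * (c 3 1).factorial *
  (c 2 2).factorial * (c 3 3).factorial

/-- The permutation of the 16 places that exchanges lines `j` and `k`. -/
def lineSwap (j k : Fin 4) : Equiv.Perm (Fin 4 × Fin 4) :=
  (Equiv.swap j k).prodCongr (Equiv.refl (Fin 4))

/-- The permutation of the 16 places that exchanges columns `j` and `k`. -/
def colSwap (j k : Fin 4) : Equiv.Perm (Fin 4 × Fin 4) :=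
  (Equiv.refl (Fin 4)).prodCongr (Equiv.swap j k)

/-- `𝔥 = (c₁₁ c₃₃)(c₁₃ c₃₁)(c₂₂ c₄₄)(c₂₄ c₄₂)`. -/
def hPerm : Equiv.Perm (Fin 4 × Fin 4) :=
  Equiv.swap (0, 0) (2, 2) * Equiv.swap (0, 2) (2, 0) *
  Equiv.swap (1, 1) (3, 3) * Equiv.swap (1, 3) (3, 1)

/-- The group `𝔊 = ⟨𝔞₁, 𝔞₂, 𝔞₃, 𝔟, 𝔥⟩` of permutations of the 16 places of the matrix;
`𝔞_j` exchanges lines `j` and `4`, `𝔟` exchanges columns `3` and `4`. -/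
def groupG : Subgroup (Equiv.Perm (Fin 4 × Fin 4)) :=
  Subgroup.closure {lineSwap 0 3, lineSwap 1 3, lineSwap 2 3, colSwap 2 3, hPerm}

/-- The action of a permutation of the places on matrices: the entry at the place `p`
is moved to the place `g p`. -/
def permute (g : Equiv.Perm (Fin 4 × Fin 4)) (c : Matrix (Fin 4) (Fin 4) ℕ) :
    Matrix (Fin 4) (Fin 4) ℕ :=
  Matrix.of fun j k => c (g⁻¹ (j, k)).1 (g⁻¹ (j, k)).2

/-- Invariance of `R` under a common integer shift of the parameters. -/
theorem R_shift (a b : Fin 4 → ℤ) (s : ℤ) (t : ℝ) :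
    R (fun j => a j + s) (fun k => b k + s) t = R a b (t + s) := by
  simp only [R, upper, lower, add_sub_add_right_eq_sub, Int.cast_add]
  have e : ∀ x i : ℝ, t + (x + s) + i = t + s + x + i := fun x i => by ring
  simp only [e]

/-- Invariance of `G` under a common integer shift of the parameters. -/
theorem G_shift (a b : Fin 4 → ℤ) (s : ℤ) :
    G (fun j => a j + s) (fun k => b k + s) = G a b := by
  have h1 : R (fun j => a j + s) (fun k => b k + s) = fun t => R a b (t + s) :=
    funext fun t => R_shift a b s t
  have h2 : (-1 : ℝ) ^ (b 0 + s + (b 1 + s)) = (-1 : ℝ) ^ (b 0 + b 1) := by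
    have : b 0 + s + (b 1 + s) = (b 0 + b 1) + (s + s) := by ring
    rw [this, zpow_add₀ (by norm_num), Even.neg_one_zpow ⟨s, rfl⟩, mul_one]
  simp only [G, h1, h2]
  congr 1
  refine tsum_congr fun n => ?_
  rw [deriv_comp_add_const]
  congr 1
  have : max (b 0 + s) (b 1 + s) = max (b 0) (b 1) + s := (max_add_add_right _ _ _)
  rw [this]
  push_cast
  ring

/-- `H` is well defined: `H(c) = G(a, b)` for all parameters `(a, b)` that give `c`. -/
theorem H_cMatrix {a b : Fin 4 → ℤ} (h : IsParam a b) : H (cMatrix a b) = G a b := by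
  rw [H, ← G_shift a b (1 - b 0)]
  obtain ⟨h0, h1, h2, h3, -⟩ := h
  have ha : aOf (cMatrix a b) = fun j => a j + (1 - b 0) := by
    funext j
    have := h0 j
    simp only [aOf, cMatrix, Matrix.of_apply]
    rw [if_pos this]
    omega
  have hb : bOf (cMatrix a b) = fun k => b k + (1 - b 0) := by
    have e0 := h0 0
    have e1 := h1 0
    have e2 := h2 0
    have e3 := h3 0
    funext k
    fin_cases k <;>
      simp [bOf, cMatrix, h0 0, h1 0, not_le.2 (h2 0), not_le.2 (h3 0)] <;> omega
  rw [ha, hb]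

/-- The series that defines `G(a, b)` converges absolutely. -/
theorem summable_deriv_R {a b : Fin 4 → ℤ} (h : IsParam a b) :
    Summable fun n : ℕ => deriv (R a b) (((1 - max (b 0) (b 1) + n : ℤ)) : ℝ) := by
  obtain ⟨h0, h1, h2, h3, hbal⟩ := h
  let F : ℤ → ℕ → Polynomial ℝ := fun x n =>
    ∏ i ∈ range n, (Polynomial.X + Polynomial.C ((x : ℝ) + i))
  have Fm : ∀ x n, (F x n).Monic := fun x n =>
    Polynomial.monic_prod_of_monic _ _ fun i _ => Polynomial.monic_X_add_C _
  have Fd : ∀ x n, (F x n).natDegree = n := fun x n => by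
    simp only [F]
    rw [Polynomial.natDegree_prod_of_monic _ _ fun i _ => Polynomial.monic_X_add_C _,
      Finset.sum_congr rfl fun (i : ℕ) _ => Polynomial.natDegree_X_add_C ((x : ℝ) + (i : ℕ))]
    simp
  have Fe : ∀ (x : ℤ) (n : ℕ) (t : ℝ), (F x n).eval t = ∏ i ∈ range n, (t + x + i) :=
    fun x n t => by
      simp only [F, Polynomial.eval_prod, Polynomial.eval_add, Polynomial.eval_X,
        Polynomial.eval_C, add_assoc]
  obtain ⟨P, hP⟩ : ∃ P, P = F (b 0) (a 0 - b 0).toNat * F (b 1) (a 1 - b 1).toNat := ⟨_, rfl⟩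
  obtain ⟨Q, hQ⟩ : ∃ Q, Q = F (a 2) (b 2 - a 2).toNat * F (a 3) (b 3 - a 3).toNat := ⟨_, rfl⟩
  have Qm : Q.Monic := hQ ▸ (Fm _ _).mul (Fm _ _)
  have Pd : P.natDegree = (a 0 - b 0).toNat + (a 1 - b 1).toNat := by
    rw [hP, (Fm _ _).natDegree_mul (Fm _ _), Fd, Fd]
  have Qd : Q.natDegree = (b 2 - a 2).toNat + (b 3 - a 3).toNat := by
    rw [hQ, (Fm _ _).natDegree_mul (Fm _ _), Fd, Fd]
  have deg : P.natDegree + 2 = Q.natDegree := by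
    have := h0 0
    have := h1 1
    have := h2 2
    have := h3 3
    omega
  obtain ⟨K, hK⟩ : ∃ K : ℝ, R a b = fun t => K * (P.eval t / Q.eval t) := by
    refine ⟨((b 2 - a 2 - 1).toNat.factorial : ℝ) * ((b 3 - a 3 - 1).toNat.factorial : ℝ) /
      (((a 0 - b 0).toNat.factorial : ℝ) * ((a 1 - b 1).toNat.factorial : ℝ)), ?_⟩
    funext t
    simp only [R, upper, lower, hP, hQ, Polynomial.eval_mul, Fe, div_eq_mul_inv, mul_inv]
    ring
  let N : Polynomial ℝ := Polynomial.derivative P * Q - P * Polynomial.derivative Q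
  have Nd : (N * Polynomial.X ^ 2).degree ≤ (Q ^ 2).degree := by
    have e1 : N.natDegree ≤ P.natDegree + Q.natDegree := by
      refine (Polynomial.natDegree_sub_le _ _).trans (max_le ?_ ?_)
      · have := Polynomial.natDegree_derivative_le P
        exact Polynomial.natDegree_mul_le.trans (by omega)
      · have := Polynomial.natDegree_derivative_le Q
        exact Polynomial.natDegree_mul_le.trans (by omega)
    rw [Polynomial.degree_eq_natDegree (pow_ne_zero 2 Qm.ne_zero), Qm.natDegree_pow]
    refine Polynomial.degree_le_of_natDegree_le (Polynomial.natDegree_mul_le.trans ?_)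
    rw [Polynomial.natDegree_X_pow]
    omega
  have hO := Polynomial.isBigO_atTop_of_degree_le _ _ Nd
  have hlim : Filter.Tendsto (fun n : ℕ => (((1 - max (b 0) (b 1) + n : ℤ)) : ℝ))
      Filter.atTop Filter.atTop := by
    push_cast
    exact Filter.tendsto_atTop_add_const_left _ _ tendsto_natCast_atTop_atTop
  have hQ0 : ∀ᶠ t in Filter.atTop, Q.eval t ≠ 0 := by
    filter_upwards [Q.eventually_atTop_not_isRoot Qm.ne_zero] with t ht using ht
  have hder : ∀ᶠ t in Filter.atTop, deriv (R a b) t = K * (N.eval t / (Q ^ 2).eval t) := by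
    filter_upwards [hQ0] with t ht
    rw [hK]
    have := ((P.hasDerivAt t).div (Q.hasDerivAt t) ht).const_mul K
    rw [Polynomial.eval_pow]
    simpa [N] using this.deriv
  have key : deriv (R a b) =O[Filter.atTop] fun t : ℝ => 1 / |t| ^ (2 : ℝ) := by
    obtain ⟨C, hC⟩ := hO.bound
    refine Asymptotics.IsBigO.of_bound (|K| * C) ?_
    filter_upwards [hder, hC, hQ0, Filter.eventually_gt_atTop 0] with t e1 e2 e3 e4
    have q : 0 < |(Q ^ 2).eval t| := by
      rw [Polynomial.eval_pow]
      positivity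
    rw [e1]
    simp only [Polynomial.eval_mul, Polynomial.eval_pow, Polynomial.eval_X, Real.norm_eq_abs,
      abs_mul, abs_div, abs_pow, abs_abs, abs_one, Real.rpow_ofNat] at e2 q ⊢
    rw [mul_assoc]
    refine mul_le_mul_of_nonneg_left ?_ (abs_nonneg _)
    rw [mul_one_div, div_le_div_iff₀ q (by positivity)]
    exact e2
  refine summable_of_isBigO_nat ?_ (key.comp_tendsto hlim)
  have := (Real.summable_one_div_nat_add_rpow (1 - max (b 0) (b 1) : ℤ) 2).2 one_lt_two
  refine this.congr fun n => ?_
  simp only [Function.comp_apply]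
  push_cast
  rw [add_comm]

end ZetaThree

namespace ZetaThree

open Finset Filter Topology

/-! ### Quotients of Gamma functions -/

/-! Where all `t + a_j` are positive, `R` is the constant c₃₃! c₄₄! / (c₁₁! c₂₂!) times `rho`, a
quotient of Gamma products that is symmetric in the `a_j` and in the `b_k`. Absorbing the constant
into `Π` turns `H / Π` into `-signedSum / facDenom` (`IsParam.quotient_eq`), and in this form
invariance under exchanges of lines and of columns 3, 4 is visible.

The substance is `𝔥`. On parameters it adds n = b₁ + b₃ - 1 - a₁ - a₃ to a₁, a₃, b₂, b₄, and n = 0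
is trivial. For n > 0, a termwise three-term relation (`rhoSum_contiguous`) links the sum to two
sums whose shift is n - 1. The three images are linked in turn by `rhoSum_contiguous_image`, which
holds only after summation, its terms adding up to a telescoping difference. Up to the factorials in
`facDenom` the two relations have the same coefficients, so induction on n applies
(`signedSum_image`). If n < 0, the image has shift -n, and `𝔥` is an involution. -/

theorem inv_Gamma_eq (s : ℝ) : (Real.Gamma s)⁻¹ = s * (Real.Gamma (s + 1))⁻¹ := by
  rcases eq_or_ne s 0 with rfl | hs
  · simp
  · rw [Real.Gamma_add_one hs, mul_inv, mul_inv_cancel_left₀ hs]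

/-- With the value 0 of `Real.Gamma` at its poles and `0⁻¹ = 0`, this is the restriction of the
entire function 1/Γ. Thus `rho` can be differentiated at its zeros too. -/
theorem differentiable_inv_Gamma : Differentiable ℝ fun s : ℝ => (Real.Gamma s)⁻¹ := fun s => by
  have h := (Complex.differentiable_one_div_Gamma (s : ℂ)).hasDerivAt.real_of_complex
  refine h.differentiableAt.congr_of_eventuallyEq (Eventually.of_forall fun x => ?_)
  simp only [Complex.Gamma_ofReal]
  rw [← Complex.ofReal_inv, Complex.ofReal_re]

/-- Only `x + n` has to be positive: at integers `x ≤ 0` both sides vanish, and the zeros of `rho`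
arise there. -/
theorem Gamma_add_nat_mul_inv (n : ℕ) : ∀ x : ℝ, 0 < x + n →
    Real.Gamma (x + n) * (Real.Gamma x)⁻¹ = ∏ i ∈ range n, (x + i) := by
  induction n with
  | zero =>
    intro x hx
    have := (Real.Gamma_pos_of_pos hx).ne'
    simp only [Nat.cast_zero, add_zero] at *
    simp [this]
  | succ n ih =>
    intro x hx
    push_cast at hx ⊢
    have := ih (x + 1) (by linarith)
    rw [prod_range_succ', inv_Gamma_eq]
    have e : x + (n + 1) = x + 1 + n := by ring
    rw [e, mul_left_comm, this, mul_comm]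
    push_cast
    simp [add_assoc, add_comm (1 : ℝ)]

theorem Gamma_mul_inv_Gamma_add_nat {x : ℝ} (hx : 0 < x) (n : ℕ) :
    Real.Gamma x * (Real.Gamma (x + n))⁻¹ = (∏ i ∈ range n, (x + i))⁻¹ := by
  rw [← Gamma_add_nat_mul_inv n x (by positivity), mul_inv, inv_inv, mul_comm]

/-- The symmetric function `∏ Γ(t + a_j) / ∏ Γ(t + b_k)`. -/
noncomputable def rho (a b : Fin 4 → ℤ) (t : ℝ) : ℝ :=
  (∏ j, Real.Gamma (t + a j)) * ∏ k, (Real.Gamma (t + b k))⁻¹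

theorem differentiableAt_rho (a b : Fin 4 → ℤ) {t : ℝ} (h : ∀ j, 0 < t + a j) :
    DifferentiableAt ℝ (rho a b) t := by
  refine DifferentiableAt.mul (DifferentiableAt.fun_finsetProd fun j _ => ?_)
    (DifferentiableAt.fun_finsetProd fun k _ => ?_)
  · refine (Real.differentiableAt_Gamma fun m hm => ?_).comp t (by fun_prop)
    have := h j
    have : (0 : ℝ) ≤ m := m.cast_nonneg
    linarith
  · exact (differentiable_inv_Gamma _).comp t (by fun_prop)

/-- `rho a b` has a double zero where both `t + b₁` and `t + b₂` are non-positive. -/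
theorem deriv_rho_eq_zero (a b : Fin 4 → ℤ) {t : ℤ} (h : ∀ j, 0 < t + a j)
    (h0 : t + b 0 ≤ 0) (h1 : t + b 1 ≤ 0) : deriv (rho a b) t = 0 := by
  have key : ∀ k, t + b k ≤ 0 → (Real.Gamma ((t : ℝ) + b k))⁻¹ = 0 := fun k hk => by
    rw [inv_eq_zero, Real.Gamma_eq_zero_iff]
    refine ⟨(-(t + b k)).toNat, ?_⟩
    have : (((-(t + b k)).toNat : ℤ) : ℝ) = ((-(t + b k) : ℤ) : ℝ) := by
      rw [Int.toNat_of_nonneg (by omega)]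
    push_cast at this
    rw [this]
    ring
  let g : ℝ → ℝ := fun s => (∏ j, Real.Gamma (s + a j)) *
    ((Real.Gamma (s + b 2))⁻¹ * (Real.Gamma (s + b 3))⁻¹)
  have hi : ∀ k, DifferentiableAt ℝ (fun s : ℝ => (Real.Gamma (s + b k))⁻¹) t := fun k =>
    (differentiable_inv_Gamma _).comp _ (by fun_prop)
  have hg : DifferentiableAt ℝ g t := by
    refine DifferentiableAt.mul (DifferentiableAt.fun_finsetProd fun j _ => ?_)
      ((hi 2).mul (hi 3))
    refine (Real.differentiableAt_Gamma fun m hm => ?_).comp (t : ℝ) (by fun_prop)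
    have h' : (0 : ℝ) < t + a j := by exact_mod_cast h j
    have : (0 : ℝ) ≤ m := m.cast_nonneg
    linarith
  have e : rho a b = fun s => (Real.Gamma (s + b 0))⁻¹ * ((Real.Gamma (s + b 1))⁻¹ * g s) := by
    funext s
    simp only [rho, g, Fin.prod_univ_four]
    ring
  rw [e]
  have := ((hi 0).hasDerivAt.mul ((hi 1).mul hg).hasDerivAt).deriv
  simp only [Pi.mul_apply, key 0 h0, key 1 h1, zero_mul, mul_zero, add_zero] at this
  exact this

theorem rho_eq_div (a b : Fin 4 → ℤ) (h0 : b 0 ≤ a 0) (h1 : b 1 ≤ a 1) (h2 : a 2 ≤ b 2)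
    (h3 : a 3 ≤ b 3) {t : ℝ} (h : ∀ j, 0 < t + a j) :
    rho a b t = (∏ i ∈ range (a 0 - b 0).toNat, (t + b 0 + i)) *
      (∏ i ∈ range (a 1 - b 1).toNat, (t + b 1 + i)) /
      ((∏ i ∈ range (b 2 - a 2).toNat, (t + a 2 + i)) *
        ∏ i ∈ range (b 3 - a 3).toNat, (t + a 3 + i)) := by
  have up : ∀ k, b k ≤ a k → Real.Gamma (t + a k) * (Real.Gamma (t + b k))⁻¹ =
      ∏ i ∈ range (a k - b k).toNat, (t + b k + i) := fun k hk => by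
    have e : (a k : ℝ) = b k + (a k - b k).toNat := by
      have := Int.toNat_of_nonneg (sub_nonneg.2 hk)
      rify at this
      linarith
    rw [← Gamma_add_nat_mul_inv, add_assoc, ← e]
    rw [add_assoc, ← e]
    exact h k
  have lo : ∀ k, a k ≤ b k → Real.Gamma (t + a k) * (Real.Gamma (t + b k))⁻¹ =
      (∏ i ∈ range (b k - a k).toNat, (t + a k + i))⁻¹ := fun k hk => by
    have e : (b k : ℝ) = a k + (b k - a k).toNat := by
      have := Int.toNat_of_nonneg (sub_nonneg.2 hk)
      rify at this
      linarith
    rw [← Gamma_mul_inv_Gamma_add_nat (h k), add_assoc, ← e]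
  rw [div_eq_mul_inv, mul_inv, ← up 0 h0, ← up 1 h1, ← lo 2 h2, ← lo 3 h3]
  simp only [rho, Fin.prod_univ_four]
  ring

/-! ### The series of derivatives -/

/-- The constant factor `c₃₃! c₄₄! / (c₁₁! c₂₂!)` of `R`. -/
noncomputable def scale (a b : Fin 4 → ℤ) : ℝ :=
  ((b 2 - a 2 - 1).toNat.factorial : ℝ) * ((b 3 - a 3 - 1).toNat.factorial : ℝ) /
      (((a 0 - b 0).toNat.factorial : ℝ) * ((a 1 - b 1).toNat.factorial : ℝ))

theorem scale_pos (a b : Fin 4 → ℤ) : 0 < scale a b := by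
  unfold scale
  positivity

theorem IsParam.R_eq {a b : Fin 4 → ℤ} (hp : IsParam a b) {t : ℝ} (h : ∀ j, 0 < t + a j) :
    R a b t = scale a b * rho a b t := by
  rw [rho_eq_div a b (hp.b0_le 0) (hp.b1_le 1) (hp.lt_b2 2).le (hp.lt_b3 3).le h]
  simp only [R, upper, lower, scale, div_eq_mul_inv, mul_inv]
  ring

theorem eventually_pos_add (a : Fin 4 → ℤ) {t : ℝ} (h : ∀ j, 0 < t + a j) :
    ∀ᶠ s : ℝ in 𝓝 t, ∀ j, 0 < s + a j := by
  refine eventually_all.2 fun j => ?_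
  have : ContinuousAt (fun s : ℝ => s + a j) t := by fun_prop
  exact this.eventually (lt_mem_nhds (h j))

theorem IsParam.deriv_R {a b : Fin 4 → ℤ} (hp : IsParam a b) {t : ℝ} (h : ∀ j, 0 < t + a j) :
    deriv (R a b) t = scale a b * deriv (rho a b) t := by
  rw [← deriv_const_mul _ (differentiableAt_rho a b h)]
  refine EventuallyEq.deriv_eq ?_
  filter_upwards [eventually_pos_add a h] with s hs using hp.R_eq hs

/-- The sum of `rho'` from `1 - max {b₁, b₂}` on. -/
noncomputable def rhoSum (a b : Fin 4 → ℤ) : ℝ :=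
  ∑' n : ℕ, deriv (rho a b) (((1 - max (b 0) (b 1) + n : ℤ)) : ℝ)

theorem IsParam.pos_add {a b : Fin 4 → ℤ} (hp : IsParam a b) (n : ℕ) (j : Fin 4) :
    (0 : ℝ) < (((1 - max (b 0) (b 1) + n : ℤ)) : ℝ) + a j := by
  have := hp.b0_le j
  have := hp.b1_le j
  have h : 0 < 1 - max (b 0) (b 1) + n + a j := by omega
  exact_mod_cast h

theorem IsParam.G_eq {a b : Fin 4 → ℤ} (hp : IsParam a b) :
    G a b = -(-1 : ℝ) ^ (b 0 + b 1) * (scale a b * rhoSum a b) := by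
  rw [G, rhoSum, ← tsum_mul_left (a := scale a b)]
  congr 1
  exact tsum_congr fun n => hp.deriv_R (hp.pos_add n)

theorem IsParam.hasSum_max {a b : Fin 4 → ℤ} (hp : IsParam a b) :
    HasSum (fun n : ℕ => deriv (rho a b) (((1 - max (b 0) (b 1) + n : ℤ)) : ℝ)) (rhoSum a b) := by
  refine Summable.hasSum ?_
  have := (summable_deriv_R hp).mul_left (scale a b)⁻¹
  refine this.congr fun n => ?_
  rw [hp.deriv_R (hp.pos_add n), inv_mul_cancel_left₀ (scale_pos a b).ne']

/-- The summation may start anywhere in the range of double zeros. -/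
theorem IsParam.hasSum {a b : Fin 4 → ℤ} (hp : IsParam a b) {s : ℤ} (h : ∀ j, 0 < s + a j)
    (h0 : s + b 0 ≤ 1) (h1 : s + b 1 ≤ 1) :
    HasSum (fun n : ℕ => deriv (rho a b) ((s + n : ℤ) : ℝ)) (rhoSum a b) := by
  obtain ⟨d, hd⟩ : ∃ d : ℕ, 1 - max (b 0) (b 1) = s + d :=
    ⟨(1 - max (b 0) (b 1) - s).toNat, by omega⟩
  have key := hp.hasSum_max
  rw [hd] at key
  have e : (fun n : ℕ => deriv (rho a b) ((s + d + n : ℤ) : ℝ)) =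
      fun n : ℕ => (fun m : ℕ => deriv (rho a b) ((s + m : ℤ) : ℝ)) (n + d) := by
    funext n
    push_cast
    congr 1
    ring
  rw [e] at key
  have key := (hasSum_nat_add_iff (f := fun m : ℕ => deriv (rho a b) ((s + m : ℤ) : ℝ)) d).1 key
  -- The `d` additional terms lie at points `t ≤ -max (b 0) (b 1)`, which are double zeros of `rho`.
  rwa [sum_eq_zero, add_zero] at key
  intro i hi
  rw [mem_range] at hi
  refine deriv_rho_eq_zero a b (fun j => ?_) ?_ ?_
  · have := h j
    omega
  · omega
  · omega

/-! ### Decay of derivatives and telescoping -/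

/-- Differentiation lowers degrees, so the numerator P'Q - PQ' has degree below that of Q²; a
constant Q is treated apart, because then the numerator is 0. -/
theorem tendsto_deriv_div_eval {P Q : Polynomial ℝ} (hQ : Q ≠ 0)
    (h : P.natDegree ≤ Q.natDegree) :
    Tendsto (deriv fun t => P.eval t / Q.eval t) atTop (𝓝 0) := by
  let N : Polynomial ℝ := Polynomial.derivative P * Q - P * Polynomial.derivative Q
  have hN : N.degree < (Q ^ 2).degree := by
    rcases Nat.eq_zero_or_pos Q.natDegree with h0 | h0
    · have hP := Polynomial.eq_C_of_natDegree_eq_zero (Nat.le_zero.1 (h0 ▸ h))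
      have hQ' := Polynomial.eq_C_of_natDegree_eq_zero h0
      have : N = 0 := by
        simp only [N]
        rw [hP, hQ']
        simp
      rw [this, Polynomial.degree_zero, bot_lt_iff_ne_bot, Ne, Polynomial.degree_eq_bot]
      exact pow_ne_zero 2 hQ
    · refine Polynomial.degree_lt_degree ?_
      rw [Polynomial.natDegree_pow]
      refine (Polynomial.natDegree_sub_le _ _).trans_lt (max_lt ?_ ?_)
      · rcases Nat.eq_zero_or_pos P.natDegree with h1 | h1
        · rw [Polynomial.eq_C_of_natDegree_eq_zero h1]
          simpa using h0
        · have := Polynomial.natDegree_derivative_lt h1.ne'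
          exact Polynomial.natDegree_mul_le.trans_lt (by omega)
      · have := Polynomial.natDegree_derivative_lt h0.ne'
        exact Polynomial.natDegree_mul_le.trans_lt (by omega)
  refine (Polynomial.div_tendsto_atTop_zero_of_degree_lt _ _ hN).congr' ?_
  filter_upwards [Q.eventually_atTop_not_isRoot hQ] with t ht
  have := ((P.hasDerivAt t).div (Q.hasDerivAt t) ht).deriv
  rw [Polynomial.eval_pow]
  simp only [N, Polynomial.eval_sub, Polynomial.eval_mul]
  exact this.symm

/-- The monic polynomial `(X + x)(X + x + 1) ⋯ (X + x + n - 1)`. -/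
noncomputable def rising (x : ℤ) (n : ℕ) : Polynomial ℝ :=
  ∏ i ∈ range n, (Polynomial.X + Polynomial.C ((x : ℝ) + i))

theorem rising_monic (x : ℤ) (n : ℕ) : (rising x n).Monic :=
  Polynomial.monic_prod_of_monic _ _ fun _ _ => Polynomial.monic_X_add_C _

theorem natDegree_rising (x : ℤ) (n : ℕ) : (rising x n).natDegree = n := by
  rw [rising, Polynomial.natDegree_prod_of_monic _ _ fun i _ => Polynomial.monic_X_add_C _,
    Finset.sum_congr rfl fun (i : ℕ) _ => Polynomial.natDegree_X_add_C ((x : ℝ) + (i : ℕ))]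
  simp

theorem eval_rising (x : ℤ) (n : ℕ) (t : ℝ) :
    (rising x n).eval t = ∏ i ∈ range n, (t + x + i) := by
  simp only [rising, Polynomial.eval_prod, Polynomial.eval_add, Polynomial.eval_X,
    Polynomial.eval_C, add_assoc]

/-- Equality of the two sums is allowed because the telescoping function has degree 0: it need not
tend to 0, but its derivative does. -/
theorem tendsto_deriv_rho (a b : Fin 4 → ℤ) (h0 : b 0 ≤ a 0) (h1 : b 1 ≤ a 1) (h2 : a 2 ≤ b 2)
    (h3 : a 3 ≤ b 3) (hs : a 0 + a 1 + a 2 + a 3 ≤ b 0 + b 1 + b 2 + b 3) :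
    Tendsto (deriv (rho a b)) atTop (𝓝 0) := by
  have hQ := (rising_monic (a 2) (b 2 - a 2).toNat).mul (rising_monic (a 3) (b 3 - a 3).toNat)
  have lim := tendsto_deriv_div_eval
    (P := rising (b 0) (a 0 - b 0).toNat * rising (b 1) (a 1 - b 1).toNat) hQ.ne_zero (by
      rw [(rising_monic _ _).natDegree_mul (rising_monic _ _),
        (rising_monic _ _).natDegree_mul (rising_monic _ _)]
      simp only [natDegree_rising]
      omega)
  refine lim.congr' ?_
  have hev : ∀ᶠ t : ℝ in atTop, ∀ j, 0 < t + a j := eventually_all.2 fun j => by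
    filter_upwards [eventually_gt_atTop (-(a j : ℝ))] with t ht
    linarith
  filter_upwards [hev] with t ht
  refine EventuallyEq.deriv_eq ?_
  filter_upwards [eventually_pos_add a ht] with s hs
  simp only [rho_eq_div a b h0 h1 h2 h3 hs, Polynomial.eval_mul, eval_rising]

theorem HasSum.eq_zero_of_telescope {D : ℕ → ℝ} {s : ℝ}
    (h : HasSum (fun n => D (n + 1) - D n) s) (h0 : D 0 = 0) (hD : Tendsto D atTop (𝓝 0)) :
    s = 0 := by
  have := h.tendsto_sum_nat
  simp only [sum_range_sub, h0, sub_zero] at this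
  exact tendsto_nhds_unique this hD

/-! ### Contiguity relations -/

theorem isParam_iff (a0 a1 a2 a3 b0 b1 b2 b3 : ℤ) :
    IsParam ![a0, a1, a2, a3] ![b0, b1, b2, b3] ↔
      (b0 ≤ a0 ∧ b0 ≤ a1 ∧ b0 ≤ a2 ∧ b0 ≤ a3) ∧ (b1 ≤ a0 ∧ b1 ≤ a1 ∧ b1 ≤ a2 ∧ b1 ≤ a3) ∧
      (a0 < b2 ∧ a1 < b2 ∧ a2 < b2 ∧ a3 < b2) ∧ (a0 < b3 ∧ a1 < b3 ∧ a2 < b3 ∧ a3 < b3) ∧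
      a0 + a1 + a2 + a3 = b0 + b1 + b2 + b3 - 2 := by
  constructor
  · rintro ⟨h0, h1, h2, h3, h4⟩
    refine ⟨⟨h0 0, h0 1, h0 2, h0 3⟩, ⟨h1 0, h1 1, h1 2, h1 3⟩, ⟨h2 0, h2 1, h2 2, h2 3⟩,
      ⟨h3 0, h3 1, h3 2, h3 3⟩, h4⟩
  · rintro ⟨h0, h1, h2, h3, h4⟩
    refine ⟨?_, ?_, ?_, ?_, h4⟩ <;> intro j <;> fin_cases j <;> simp <;> tauto

theorem forall_fin_four {p : Fin 4 → Prop} : (∀ j, p j) ↔ p 0 ∧ p 1 ∧ p 2 ∧ p 3 := by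
  constructor
  · intro h
    exact ⟨h 0, h 1, h 2, h 3⟩
  · rintro ⟨h0, h1, h2, h3⟩ j
    fin_cases j <;> assumption

theorem Gamma_cast_add_one {t : ℝ} (a : ℤ) (h : 0 < t + a) :
    Real.Gamma (t + (a + 1 : ℤ)) = (t + a) * Real.Gamma (t + a) := by
  rw [← Real.Gamma_add_one h.ne']
  push_cast
  ring_nf

theorem inv_Gamma_cast_sub_one (t : ℝ) (b : ℤ) :
    (Real.Gamma (t + (b - 1 : ℤ)))⁻¹ = (t + b - 1) * (Real.Gamma (t + b))⁻¹ := by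
  rw [inv_Gamma_eq]
  push_cast
  ring_nf

theorem deriv_linear_comb {f g h : ℝ → ℝ} {t x y z : ℝ} (hf : DifferentiableAt ℝ f t)
    (hg : DifferentiableAt ℝ g t) (hh : DifferentiableAt ℝ h t) :
    deriv (fun s => x * f s + y * g s + z * h s) t = x * deriv f t + y * deriv g t +
      z * deriv h t :=
  (((hf.hasDerivAt.const_mul x).add (hg.hasDerivAt.const_mul y)).add
    (hh.hasDerivAt.const_mul z)).deriv

/-- The relation holds term by term. Relative to the `rho` with `b3 + 1` in place of `b3`, the three
functions carry the factors t + b3, t + a0 and t + b0 - 1, and three linear polynomials are linearly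
dependent. -/
theorem rhoSum_contiguous {a0 a1 a2 a3 b0 b1 b2 b3 : ℤ}
    (hp : IsParam ![a0, a1, a2, a3] ![b0, b1, b2, b3])
    (h2 : a0 + 1 < b2) :
    ((a0 - b0 + 1 : ℤ) : ℝ) * rhoSum ![a0, a1, a2, a3] ![b0, b1, b2, b3] =
      ((b3 - b0 + 1 : ℤ) : ℝ) * rhoSum ![a0 + 1, a1, a2, a3] ![b0, b1, b2, b3 + 1] -
      ((b3 - a0 : ℤ) : ℝ) * rhoSum ![a0, a1, a2, a3] ![b0 - 1, b1, b2, b3 + 1] := by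
  have hA : IsParam ![a0 + 1, a1, a2, a3] ![b0, b1, b2, b3 + 1] := by
    rw [isParam_iff] at *
    omega
  have hB : IsParam ![a0, a1, a2, a3] ![b0 - 1, b1, b2, b3 + 1] := by
    rw [isParam_iff] at *
    omega
  have hp' := (isParam_iff ..).1 hp
  -- One starting point for all three series; lowering `b0` may move the series' own start to the
  -- right, and the extra terms are zero.
  obtain ⟨s, hs⟩ : ∃ s, s = 1 - max b0 b1 := ⟨_, rfl⟩
  have S := hp.hasSum (s := s) (forall_fin_four.2 (by simp; omega)) (by simp; omega)
    (by simp; omega)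
  have SA := hA.hasSum (s := s) (forall_fin_four.2 (by simp; omega)) (by simp; omega)
    (by simp; omega)
  have SB := hB.hasSum (s := s) (forall_fin_four.2 (by simp; omega)) (by simp; omega)
    (by simp; omega)
  have key := ((S.mul_left (-((a0 - b0 + 1 : ℤ) : ℝ))).add
    (SA.mul_left ((b3 - b0 + 1 : ℤ) : ℝ))).add (SB.mul_left (-((b3 - a0 : ℤ) : ℝ)))
  have := key.unique (hasSum_zero.congr_fun fun n => ?_)
  · linear_combination -this
  have pos : ∀ j, (0 : ℝ) < ((s + n : ℤ) : ℝ) + (![a0, a1, a2, a3] j : ℤ) := by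
    refine forall_fin_four.2 ?_
    norm_cast
    simp
    omega
  have posA : ∀ j, (0 : ℝ) < ((s + n : ℤ) : ℝ) + (![a0 + 1, a1, a2, a3] j : ℤ) := by
    refine forall_fin_four.2 ?_
    norm_cast
    simp
    omega
  rw [← deriv_linear_comb (differentiableAt_rho _ _ pos) (differentiableAt_rho _ _ posA)
    (differentiableAt_rho _ _ pos)]
  refine (EventuallyEq.deriv_eq (f := fun _ => (0 : ℝ)) ?_).trans (deriv_const _ _)
  filter_upwards [eventually_pos_add _ pos] with t ht
  have e := inv_Gamma_cast_sub_one t (b3 + 1)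
  rw [add_sub_cancel_right] at e
  have h0 := ht 0
  simp only [Matrix.cons_val_zero] at h0
  simp only [rho, Fin.prod_univ_four, Matrix.cons_val, e, inv_Gamma_cast_sub_one t b0,
    Gamma_cast_add_one a0 h0]
  push_cast
  ring

/-- Let B be ∏ Γ(t + a'_j) / ∏ Γ(t + b_k) with a' = (a0 - 1, a1, a2 - 1, a3). The three functions
are B times (t + a0 - 1)(t + a2 - 1), (t + a0 - 1)(t + b1 - 1), (t + b0 - 1)(t + b1 - 1). Their
combination is σ(t + 1) - σ(t), where σ(t) = B ∏ (t + b_k - 1) and σ(t + 1) = B (t + a0 - 1)(t +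
a1)(t + a2 - 1)(t + a3); by the balance condition the quartic and cubic terms cancel. -/
theorem rhoSum_contiguous_image {a0 a1 a2 a3 b0 b1 b2 b3 : ℤ}
    (hp : IsParam ![a0, a1, a2, a3] ![b0, b1, b2, b3])
    (h0 : ∀ j, b0 < ![a0, a1, a2, a3] j) (h1 : ∀ j, b1 < ![a0, a1, a2, a3] j) :
    ((a1 + 1 - b1 : ℤ) : ℝ) * ((a3 + 1 - b1 : ℤ) : ℝ) *
        rhoSum ![a0, a1, a2, a3] ![b0, b1, b2, b3] +
      ((a2 - b0 : ℤ) : ℝ) * ((b2 + b3 - a0 - a2 : ℤ) : ℝ) *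
        rhoSum ![a0, a1, a2 - 1, a3] ![b0, b1 - 1, b2, b3] =
      ((b2 - a0 : ℤ) : ℝ) * ((b3 - a0 : ℤ) : ℝ) *
        rhoSum ![a0 - 1, a1, a2 - 1, a3] ![b0 - 1, b1 - 1, b2, b3] := by
  have hh0 := forall_fin_four.1 h0
  have hh1 := forall_fin_four.1 h1
  simp only [Matrix.cons_val] at hh0 hh1
  have hA : IsParam ![a0, a1, a2 - 1, a3] ![b0, b1 - 1, b2, b3] := by
    rw [isParam_iff] at *
    omega
  have hB : IsParam ![a0 - 1, a1, a2 - 1, a3] ![b0 - 1, b1 - 1, b2, b3] := by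
    rw [isParam_iff] at *
    omega
  have hp' := (isParam_iff ..).1 hp
  obtain ⟨s, hs⟩ : ∃ s, s = 1 - max b0 b1 := ⟨_, rfl⟩
  have S := hp.hasSum (s := s) (forall_fin_four.2 (by simp; omega)) (by simp; omega)
    (by simp; omega)
  have SA := hA.hasSum (s := s) (forall_fin_four.2 (by simp; omega)) (by simp; omega)
    (by simp; omega)
  have SB := hB.hasSum (s := s) (forall_fin_four.2 (by simp; omega)) (by simp; omega)
    (by simp; omega)
  have key := ((S.mul_left (((a1 + 1 - b1 : ℤ) : ℝ) * ((a3 + 1 - b1 : ℤ) : ℝ))).add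
    (SA.mul_left (((a2 - b0 : ℤ) : ℝ) * ((b2 + b3 - a0 - a2 : ℤ) : ℝ)))).add
    (SB.mul_left (-(((b2 - a0 : ℤ) : ℝ) * ((b3 - a0 : ℤ) : ℝ))))
  obtain ⟨σ, hσ⟩ : ∃ σ, σ = rho ![a0 - 1, a1, a2 - 1, a3] ![b0 - 1, b1 - 1, b2 - 1, b3 - 1] :=
    ⟨_, rfl⟩
  suffices h : ∀ n : ℕ, ((a1 + 1 - b1 : ℤ) : ℝ) * ((a3 + 1 - b1 : ℤ) : ℝ) *
        deriv (rho ![a0, a1, a2, a3] ![b0, b1, b2, b3]) ((s + n : ℤ) : ℝ) +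
      ((a2 - b0 : ℤ) : ℝ) * ((b2 + b3 - a0 - a2 : ℤ) : ℝ) *
        deriv (rho ![a0, a1, a2 - 1, a3] ![b0, b1 - 1, b2, b3]) ((s + n : ℤ) : ℝ) +
      -(((b2 - a0 : ℤ) : ℝ) * ((b3 - a0 : ℤ) : ℝ)) *
        deriv (rho ![a0 - 1, a1, a2 - 1, a3] ![b0 - 1, b1 - 1, b2, b3]) ((s + n : ℤ) : ℝ) =
      deriv σ ((s + (n + 1 : ℕ) : ℤ) : ℝ) - deriv σ ((s + n : ℤ) : ℝ) by
    have := HasSum.eq_zero_of_telescope (D := fun n : ℕ => deriv σ ((s + n : ℤ) : ℝ))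
      (key.congr_fun fun n => (h n).symm) ?_ ?_
    · linear_combination this
    -- Both `b0` and `b1` are lowered in `σ`, so `s` itself is already a double zero.
    · rw [hσ, Nat.cast_zero, add_zero]
      refine deriv_rho_eq_zero _ _ (forall_fin_four.2 ?_) ?_ ?_ <;> simp <;> omega
    · have lim : Tendsto (fun n : ℕ => ((s + n : ℤ) : ℝ)) atTop atTop := by
        push_cast
        exact tendsto_atTop_add_const_left _ _ tendsto_natCast_atTop_atTop
      refine Tendsto.comp (g := deriv σ) ?_ lim
      rw [hσ]
      refine tendsto_deriv_rho _ _ ?_ ?_ ?_ ?_ ?_ <;> simp <;> omega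
  intro n
  have posB : ∀ j, (0 : ℝ) < ((s + n : ℤ) : ℝ) + (![a0 - 1, a1, a2 - 1, a3] j : ℤ) := by
    refine forall_fin_four.2 ?_
    norm_cast
    simp
    omega
  have posA : ∀ j, (0 : ℝ) < ((s + n : ℤ) : ℝ) + (![a0, a1, a2 - 1, a3] j : ℤ) := by
    refine forall_fin_four.2 ?_
    norm_cast
    simp
    omega
  have pos : ∀ j, (0 : ℝ) < ((s + n : ℤ) : ℝ) + (![a0, a1, a2, a3] j : ℤ) := by
    refine forall_fin_four.2 ?_
    norm_cast
    simp
    omega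
  have pos1 : ∀ j, (0 : ℝ) < ((s + n : ℤ) : ℝ) + 1 + (![a0 - 1, a1, a2 - 1, a3] j : ℤ) := fun j => by
    have := posB j
    linarith
  rw [← deriv_linear_comb (differentiableAt_rho _ _ pos) (differentiableAt_rho _ _ posA)
    (differentiableAt_rho _ _ posB)]
  have e1 : ((s + (n + 1 : ℕ) : ℤ) : ℝ) = ((s + n : ℤ) : ℝ) + 1 := by
    push_cast
    ring
  have d1 : DifferentiableAt ℝ (fun t => σ (t + 1)) ((s + n : ℤ) : ℝ) := by
    have : DifferentiableAt ℝ σ (((s + n : ℤ) : ℝ) + 1) := hσ ▸ differentiableAt_rho _ _ pos1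
    exact this.comp (((s + n : ℤ) : ℝ)) (by fun_prop)
  rw [e1, ← deriv_comp_add_const, ← deriv_fun_sub d1 (hσ ▸ differentiableAt_rho _ _ posB)]
  refine EventuallyEq.deriv_eq ?_
  filter_upwards [eventually_pos_add _ posB] with t ht
  have ht' := forall_fin_four.1 ht
  simp only [Matrix.cons_val] at ht'
  obtain ⟨g0, g1, g2, g3⟩ := ht'
  have f0 := Gamma_cast_add_one (a0 - 1) g0
  have f2 := Gamma_cast_add_one (a2 - 1) g2
  rw [sub_add_cancel] at f0 f2
  have f0' := Real.Gamma_add_one g0.ne'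
  have f1' := Real.Gamma_add_one g1.ne'
  have f2' := Real.Gamma_add_one g2.ne'
  have f3' := Real.Gamma_add_one g3.ne'
  have sh : ∀ x : ℤ, t + 1 + (x : ℝ) = t + x + 1 := fun x => by ring
  have sh' : ∀ x : ℤ, t + 1 + ((x - 1 : ℤ) : ℝ) = t + x := fun x => by push_cast; ring
  have i := inv_Gamma_cast_sub_one t
  have bal : (a3 : ℝ) = b0 + b1 + b2 + b3 - 2 - a0 - a1 - a2 := by
    have := hp'.2.2.2.2
    rify at this
    linarith
  rw [hσ]
  simp only [rho, Fin.prod_univ_four, Matrix.cons_val, i, sh' b0, sh' b1, sh' b2, sh' b3,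
    sh (a0 - 1), sh a1, sh (a2 - 1), sh a3, f0', f1', f2', f3', f0, f2]
  -- Protects the argument of this Gamma factor from the elimination of `a3`.
  generalize Real.Gamma (t + (a3 : ℤ)) = G3
  push_cast
  rw [bal]
  ring

/-! ### The involution `𝔥` on parameters -/

/-- The factorial of a non-negative integer, as a real number. -/
noncomputable def fac (z : ℤ) : ℝ := (z.toNat.factorial : ℝ)

theorem fac_ne_zero (z : ℤ) : fac z ≠ 0 := by
  unfold fac
  positivity

theorem fac_add_one {z : ℤ} (h : 0 ≤ z) : fac (z + 1) = (z + 1) * fac z := by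
  lift z to ℕ using h
  unfold fac
  rw [← Nat.cast_succ, Int.toNat_natCast, Int.toNat_natCast, Nat.factorial_succ]
  push_cast
  ring

theorem fac_eq {z : ℤ} (h : 0 < z) : fac z = z * fac (z - 1) := by
  have := fac_add_one (z := z - 1) (by omega)
  rw [sub_add_cancel] at this
  rw [this]
  push_cast
  ring

/-- The sum of `rho'` with the sign of `G`. -/
noncomputable def signedSum (a b : Fin 4 → ℤ) : ℝ := (-1 : ℝ) ^ (b 0 + b 1) * rhoSum a b

theorem neg_one_zpow_sub_one (n : ℤ) : (-1 : ℝ) ^ (n - 1) = -(-1 : ℝ) ^ n := by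
  rw [zpow_sub_one₀ (by norm_num)]
  norm_num

theorem signedSum_contiguous {a0 a1 a2 a3 b0 b1 b2 b3 : ℤ}
    (hp : IsParam ![a0, a1, a2, a3] ![b0, b1, b2, b3])
    (h2 : a0 + 1 < b2) :
    ((a0 - b0 + 1 : ℤ) : ℝ) * signedSum ![a0, a1, a2, a3] ![b0, b1, b2, b3] =
      ((b3 - b0 + 1 : ℤ) : ℝ) * signedSum ![a0 + 1, a1, a2, a3] ![b0, b1, b2, b3 + 1] +
      ((b3 - a0 : ℤ) : ℝ) * signedSum ![a0, a1, a2, a3] ![b0 - 1, b1, b2, b3 + 1] := by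
  have h := rhoSum_contiguous hp h2
  have e : b0 - 1 + b1 = b0 + b1 - 1 := by ring
  simp only [signedSum, Matrix.cons_val, e, neg_one_zpow_sub_one]
  linear_combination (-1 : ℝ) ^ (b0 + b1) * h

theorem signedSum_contiguous_image {a0 a1 a2 a3 b0 b1 b2 b3 : ℤ}
    (hp : IsParam ![a0, a1, a2, a3] ![b0, b1, b2, b3])
    (h0 : ∀ j, b0 < ![a0, a1, a2, a3] j) (h1 : ∀ j, b1 < ![a0, a1, a2, a3] j) :
    ((a1 + 1 - b1 : ℤ) : ℝ) * ((a3 + 1 - b1 : ℤ) : ℝ) *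
        signedSum ![a0, a1, a2, a3] ![b0, b1, b2, b3] =
      ((a2 - b0 : ℤ) : ℝ) * ((b2 + b3 - a0 - a2 : ℤ) : ℝ) *
        signedSum ![a0, a1, a2 - 1, a3] ![b0, b1 - 1, b2, b3] +
      ((b2 - a0 : ℤ) : ℝ) * ((b3 - a0 : ℤ) : ℝ) *
        signedSum ![a0 - 1, a1, a2 - 1, a3] ![b0 - 1, b1 - 1, b2, b3] := by
  have h := rhoSum_contiguous_image hp h0 h1
  have e : b0 + (b1 - 1) = b0 + b1 - 1 := by ring
  have e' : b0 - 1 + (b1 - 1) = b0 + b1 - 1 - 1 := by ring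
  simp only [signedSum, Matrix.cons_val, e, e', neg_one_zpow_sub_one]
  linear_combination (-1 : ℝ) ^ (b0 + b1) * h

/-- The factorials on the left are those of c₁₁, c₂₂, c₃₁, c₄₂, the ones on the right those of c₃₃,
c₄₄, c₁₃, c₂₄, which `𝔥` puts in their places. -/
theorem signedSum_image (n : ℕ) : ∀ {a0 a1 a2 a3 b0 b1 b2 b3 : ℤ},
    IsParam ![a0, a1, a2, a3] ![b0, b1, b2, b3] → b0 + b2 - 1 - a0 - a2 = n →
    (∀ j, b0 < ![a0, a1, a2, a3] j) → (∀ j, b1 < ![a0, a1, a2, a3] j) →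
    a1 + 1 < b3 → a3 + 1 < b3 →
    fac (a0 - b0) * fac (a1 - b1) * fac (a2 - b0) * fac (a3 - b1) *
        signedSum ![a0 + n, a1, a2 + n, a3] ![b0, b1 + n, b2, b3 + n] =
      fac (b2 - a0 - 1) * fac (b3 - a1 - 1) * fac (b2 - a2 - 1) * fac (b3 - a3 - 1) *
        signedSum ![a0, a1, a2, a3] ![b0, b1, b2, b3] := by
  induction n with
  | zero =>
    intro a0 a1 a2 a3 b0 b1 b2 b3 hp hn h0 h1 h2 h3
    have hp' := (isParam_iff ..).1 hp
    have e0 : b2 - a0 - 1 = a2 - b0 := by omega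
    have e1 : b2 - a2 - 1 = a0 - b0 := by omega
    have e2 : b3 - a1 - 1 = a3 - b1 := by omega
    have e3 : b3 - a3 - 1 = a1 - b1 := by omega
    simp only [Nat.cast_zero, add_zero, e0, e1, e2, e3]
    ring
  | succ n ih =>
    intro a0 a1 a2 a3 b0 b1 b2 b3 hp hn h0 h1 h2 h3
    have hp' := (isParam_iff ..).1 hp
    have hh0 := forall_fin_four.1 h0
    have hh1 := forall_fin_four.1 h1
    simp only [Matrix.cons_val] at hh0 hh1
    push_cast at hn ⊢
    have R1 := signedSum_contiguous hp (by omega)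
    have hq : IsParam ![a0 + (n + 1), a1, a2 + (n + 1), a3] ![b0, b1 + (n + 1), b2, b3 + (n + 1)] := by
      rw [isParam_iff]
      omega
    have R2 := signedSum_contiguous_image hq (forall_fin_four.2 (by simp; omega))
      (forall_fin_four.2 (by simp; omega))
    -- The two neighbours in `R1` have shift `n`, and their images are the two neighbours in `R2`.
    have IA := ih (a0 := a0 + 1) (a1 := a1) (a2 := a2) (a3 := a3) (b0 := b0) (b1 := b1) (b2 := b2)
      (b3 := b3 + 1) (by rw [isParam_iff]; omega) (by omega) (forall_fin_four.2 (by simp; omega))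
      (forall_fin_four.2 (by simp; omega)) (by omega) (by omega)
    have IB := ih (a0 := a0) (a1 := a1) (a2 := a2) (a3 := a3) (b0 := b0 - 1) (b1 := b1) (b2 := b2)
      (b3 := b3 + 1) (by rw [isParam_iff]; omega) (by omega) (forall_fin_four.2 (by simp; omega))
      (forall_fin_four.2 (by simp; omega)) (by omega) (by omega)
    have v1 : a0 + 1 + (n : ℤ) = a0 + (n + 1) := by ring
    have v2 : b3 + 1 + (n : ℤ) = b3 + (n + 1) := by ring
    have v3 : a0 + ((n : ℤ) + 1) - 1 = a0 + n := by ring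
    have v4 : a2 + ((n : ℤ) + 1) - 1 = a2 + n := by ring
    have v5 : b1 + ((n : ℤ) + 1) - 1 = b1 + n := by ring
    rw [v1, v2] at IA
    rw [v2] at IB
    rw [v3, v4, v5] at R2
    generalize signedSum ![a0 + (n + 1), a1, a2 + (n + 1), a3] ![b0, b1 + (n + 1), b2, b3 + (n + 1)] = X
      at *
    generalize signedSum ![a0, a1, a2, a3] ![b0, b1, b2, b3] = Y at *
    generalize signedSum ![a0 + 1, a1, a2, a3] ![b0, b1, b2, b3 + 1] = YA at *
    generalize signedSum ![a0, a1, a2, a3] ![b0 - 1, b1, b2, b3 + 1] = YB at *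
    generalize signedSum ![a0 + ((n : ℤ) + 1), a1, a2 + n, a3] ![b0, b1 + n, b2, b3 + (n + 1)] = XA at *
    generalize signedSum ![a0 + (n : ℤ), a1, a2 + n, a3] ![b0 - 1, b1 + n, b2, b3 + (n + 1)] = XB at *
    have w1 : a0 + 1 - b0 = a0 - b0 + 1 := by ring
    have w2 : b2 - (a0 + 1) - 1 = b2 - a0 - 1 - 1 := by ring
    have w3 : b3 + 1 - a1 - 1 = b3 - a1 - 1 + 1 := by ring
    have w4 : b3 + 1 - a3 - 1 = b3 - a3 - 1 + 1 := by ring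
    have w5 : a0 - (b0 - 1) = a0 - b0 + 1 := by ring
    have w6 : a2 - (b0 - 1) = a2 - b0 + 1 := by ring
    rw [w1, w2, w3, w4, fac_add_one (z := a0 - b0) (by omega),
      fac_add_one (z := b3 - a1 - 1) (by omega), fac_add_one (z := b3 - a3 - 1) (by omega)] at IA
    rw [w5, w6, w3, w4, fac_add_one (z := a0 - b0) (by omega),
      fac_add_one (z := a2 - b0) (by omega),
      fac_add_one (z := b3 - a1 - 1) (by omega), fac_add_one (z := b3 - a3 - 1) (by omega)] at IB
    rw [fac_eq (z := b2 - a0 - 1) (by omega)] at IB ⊢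
    -- By the value of the shift and the balance condition, the coefficients of `R2` are rewritten
    -- in the original parameters, to be matched with those of `R1`.
    have u1 : ((a1 + 1 - (b1 + (n + 1)) : ℤ) : ℝ) = b3 - a3 := by
      have : a1 + 1 - (b1 + (n + 1)) = b3 - a3 := by omega
      exact_mod_cast this
    have u2 : ((a3 + 1 - (b1 + (n + 1)) : ℤ) : ℝ) = b3 - a1 := by
      have : a3 + 1 - (b1 + (n + 1)) = b3 - a1 := by omega
      exact_mod_cast this
    have u3 : ((a2 + (n + 1) - b0 : ℤ) : ℝ) = b2 - a0 - 1 := by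
      have : a2 + (n + 1) - b0 = b2 - a0 - 1 := by omega
      exact_mod_cast this
    have u4 : ((b2 + (b3 + (n + 1)) - (a0 + (n + 1)) - (a2 + (n + 1)) : ℤ) : ℝ) = b3 - b0 + 1 := by
      have : b2 + (b3 + (n + 1)) - (a0 + (n + 1)) - (a2 + (n + 1)) = b3 - b0 + 1 := by omega
      exact_mod_cast this
    have u5 : ((b2 - (a0 + (n + 1)) : ℤ) : ℝ) = a2 - b0 + 1 := by
      have : b2 - (a0 + (n + 1)) = a2 - b0 + 1 := by omega
      exact_mod_cast this
    have u6 : ((b3 + (n + 1) - (a0 + (n + 1)) : ℤ) : ℝ) = b3 - a0 := by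
      have : b3 + (n + 1) - (a0 + (n + 1)) = b3 - a0 := by omega
      exact_mod_cast this
    rw [u1, u2, u3, u4, u5, u6] at R2
    push_cast at R1 IA IB ⊢
    have p1 : ((b3 : ℝ) - a3) ≠ 0 := by
      have : b3 - a3 ≠ 0 := by omega
      exact_mod_cast this
    have p2 : ((b3 : ℝ) - a1) ≠ 0 := by
      have : b3 - a1 ≠ 0 := by omega
      exact_mod_cast this
    have p3 : ((a0 : ℝ) - b0 + 1) ≠ 0 := by
      have : a0 - b0 + 1 ≠ 0 := by omega
      exact_mod_cast this
    refine mul_left_cancel₀ (mul_ne_zero (mul_ne_zero p1 p2) p3) ?_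
    generalize fac (a0 - b0) = F1 at *
    generalize fac (a1 - b1) = F2 at *
    generalize fac (a2 - b0) = F3 at *
    generalize fac (a3 - b1) = F4 at *
    generalize fac (b2 - a0 - 1 - 1) = F5 at *
    generalize fac (b3 - a1 - 1) = F6 at *
    generalize fac (b2 - a2 - 1) = F7 at *
    generalize fac (b3 - a3 - 1) = F8 at *
    linear_combination (a0 - b0 + 1 : ℝ) * F1 * F2 * F3 * F4 * R2 +
      (b2 - a0 - 1 : ℝ) * (b3 - b0 + 1 : ℝ) * IA + (b3 - a0 : ℝ) * IB -
      (b3 - a3 : ℝ) * (b3 - a1) * (b2 - a0 - 1) * F5 * F6 * F7 * F8 * R1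

/-! ### The action of the group on matrices -/

/-- The denominator `∏ c_{j1}! c_{j2}!`. -/
noncomputable def facDenom (a b : Fin 4 → ℤ) : ℝ := ∏ j, fac (a j - b 0) * fac (a j - b 1)

theorem IsParam.cMatrix_zero {a b : Fin 4 → ℤ} (hp : IsParam a b) (j : Fin 4) :
    cMatrix a b j 0 = (a j - b 0).toNat := by
  simp [cMatrix, hp.b0_le j]

theorem IsParam.cMatrix_one {a b : Fin 4 → ℤ} (hp : IsParam a b) (j : Fin 4) :
    cMatrix a b j 1 = (a j - b 1).toNat := by
  simp [cMatrix, hp.b1_le j]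

theorem IsParam.cMatrix_two {a b : Fin 4 → ℤ} (hp : IsParam a b) (j : Fin 4) :
    cMatrix a b j 2 = (b 2 - a j - 1).toNat := by
  simp [cMatrix, hp.lt_b2 j]

theorem IsParam.cMatrix_three {a b : Fin 4 → ℤ} (hp : IsParam a b) (j : Fin 4) :
    cMatrix a b j 3 = (b 3 - a j - 1).toNat := by
  simp [cMatrix, hp.lt_b3 j]

/-- The factors c₃₃! c₄₄! cancel, while c₁₁! c₂₂! complete `Π` to the product over the whole first
two columns. -/
theorem IsParam.quotient_eq {a b : Fin 4 → ℤ} (hp : IsParam a b) :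
    H (cMatrix a b) / (facProd (cMatrix a b) : ℝ) = -signedSum a b / facDenom a b := by
  rw [H_cMatrix hp, hp.G_eq]
  simp only [facProd, hp.cMatrix_zero, hp.cMatrix_one, hp.cMatrix_two, hp.cMatrix_three,
    signedSum, scale, facDenom, Fin.prod_univ_four, fac,
    Nat.cast_mul]
  field_simp

theorem signedSum_comp_left (a b : Fin 4 → ℤ) (s : Equiv.Perm (Fin 4)) :
    signedSum (fun j => a (s j)) b = signedSum a b := by
  have : rho (fun j => a (s j)) b = rho a b := by
    funext t
    rw [rho, rho, Equiv.prod_comp s fun j => Real.Gamma (t + a j)]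
  rw [signedSum, signedSum, rhoSum, rhoSum, this]

theorem facDenom_comp_left (a b : Fin 4 → ℤ) (s : Equiv.Perm (Fin 4)) :
    facDenom (fun j => a (s j)) b = facDenom a b :=
  Equiv.prod_comp s fun j => fac (a j - b 0) * fac (a j - b 1)

theorem signedSum_swap_right (a b : Fin 4 → ℤ) :
    signedSum a (fun k => b (Equiv.swap 2 3 k)) = signedSum a b := by
  have : rho a (fun k => b (Equiv.swap 2 3 k)) = rho a b := by
    funext t
    rw [rho, rho, Equiv.prod_comp (Equiv.swap 2 3) fun k => (Real.Gamma (t + b k))⁻¹]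
  rw [signedSum, signedSum, rhoSum, rhoSum, this]
  -- The sign and the start of the series involve only `b 0` and `b 1`, which the exchange fixes.
  rfl

theorem IsParam.comp_left {a b : Fin 4 → ℤ} (hp : IsParam a b) (s : Equiv.Perm (Fin 4)) :
    IsParam (fun j => a (s j)) b where
  b0_le j := hp.b0_le _
  b1_le j := hp.b1_le _
  lt_b2 j := hp.lt_b2 _
  lt_b3 j := hp.lt_b3 _
  balanced := by
    have := Equiv.sum_comp s a
    simp only [Fin.sum_univ_four] at this
    rw [this, hp.balanced]

theorem IsParam.swap_right {a b : Fin 4 → ℤ} (hp : IsParam a b) :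
    IsParam a (fun k => b (Equiv.swap 2 3 k)) where
  b0_le j := hp.b0_le _
  b1_le j := hp.b1_le _
  lt_b2 j := hp.lt_b3 _
  lt_b3 j := hp.lt_b2 _
  balanced := by
    have := Equiv.sum_comp (Equiv.swap 2 3) b
    simp only [Fin.sum_univ_four] at this
    rw [this, hp.balanced]

/-- The shift that `𝔥` induces on the parameters. -/
def hShift (a b : Fin 4 → ℤ) : ℤ := b 0 + b 2 - 1 - a 0 - a 2

/-- The action of `𝔥` on the parameters `a`. -/
def hLeft (a b : Fin 4 → ℤ) : Fin 4 → ℤ := ![a 0 + hShift a b, a 1, a 2 + hShift a b, a 3]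

/-- The action of `𝔥` on the parameters `b`. -/
def hRight (a b : Fin 4 → ℤ) : Fin 4 → ℤ := ![b 0, b 1 + hShift a b, b 2, b 3 + hShift a b]

theorem vec_eta (a : Fin 4 → ℤ) : ![a 0, a 1, a 2, a 3] = a := by
  funext j
  fin_cases j <;> rfl

theorem IsParam.image {a b : Fin 4 → ℤ} (hp : IsParam a b) :
    IsParam (hLeft a b) (hRight a b) := by
  rw [← vec_eta a, ← vec_eta b, isParam_iff] at hp
  rw [hLeft, hRight, isParam_iff, hShift]
  omega

theorem hShift_image (a b : Fin 4 → ℤ) : hShift (hLeft a b) (hRight a b) = -hShift a b := by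
  simp only [hShift, hLeft, hRight, Matrix.cons_val]
  ring

theorem hPerm_inv : hPerm⁻¹ = hPerm := by decide

theorem permute_apply (g : Equiv.Perm (Fin 4 × Fin 4)) (c : Matrix (Fin 4) (Fin 4) ℕ)
    (j k : Fin 4) : permute g c j k = c (g⁻¹ (j, k)).1 (g⁻¹ (j, k)).2 := rfl

theorem permute_one (c : Matrix (Fin 4) (Fin 4) ℕ) : permute 1 c = c := rfl

theorem permute_mul (g g' : Equiv.Perm (Fin 4 × Fin 4)) (c : Matrix (Fin 4) (Fin 4) ℕ) :
    permute (g * g') c = permute g (permute g' c) := by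
  ext j k
  simp only [permute_apply, mul_inv_rev, Equiv.Perm.mul_apply]

theorem permute_lineSwap (a b : Fin 4 → ℤ) (j k : Fin 4) :
    permute (lineSwap j k) (cMatrix a b) = cMatrix (fun i => a (Equiv.swap j k i)) b := rfl

theorem permute_colSwap {a b : Fin 4 → ℤ} :
    permute (colSwap 2 3) (cMatrix a b) = cMatrix a (fun i => b (Equiv.swap 2 3 i)) := rfl

theorem IsParam.permute_hPerm {a b : Fin 4 → ℤ} (hp : IsParam a b) :
    permute hPerm (cMatrix a b) = cMatrix (hLeft a b) (hRight a b) := by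
  have e : ∀ j k, hPerm (j, k) = (![![(2, 2), (0, 1), (2, 0), (0, 3)],
      ![(1, 0), (3, 3), (1, 2), (3, 1)], ![(0, 2), (2, 1), (0, 0), (2, 3)],
      ![(3, 0), (1, 3), (3, 2), (1, 1)]] : Fin 4 → Fin 4 → Fin 4 × Fin 4) j k := by decide
  have bal := hp.balanced
  have hq := hp.image
  ext j k
  rw [permute_apply, hPerm_inv, e]
  revert j k
  simp only [forall_fin_four, Matrix.cons_val, hp.cMatrix_zero, hp.cMatrix_one, hp.cMatrix_two,
    hp.cMatrix_three, hq.cMatrix_zero, hq.cMatrix_one, hq.cMatrix_two, hq.cMatrix_three]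
  simp only [hLeft, hRight, hShift, Matrix.cons_val, true_and]
  constructorm* _ ∧ _ <;> omega

/-- `g` maps admissible matrices to admissible ones, and so does its inverse, and it
does not change the quotient `H(c) / Π(c)`. -/
def Stabilizes (g : Equiv.Perm (Fin 4 × Fin 4)) : Prop :=
  ∀ c, (Admissible (permute g c) ↔ Admissible c) ∧ (Admissible c →
    H (permute g c) / (facProd (permute g c) : ℝ) = H c / (facProd c : ℝ))

theorem Stabilizes.mul {g g' : Equiv.Perm (Fin 4 × Fin 4)} (h : Stabilizes g)
    (h' : Stabilizes g') : Stabilizes (g * g') := fun c => by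
  rw [permute_mul]
  refine ⟨(h _).1.trans (h' c).1, fun hc => ?_⟩
  rw [(h _).2 ((h' c).1.2 hc), (h' c).2 hc]

/-- This is where the equivalence in `Stabilizes` is needed, rather than one implication. -/
theorem Stabilizes.inv {g : Equiv.Perm (Fin 4 × Fin 4)} (h : Stabilizes g) :
    Stabilizes g⁻¹ := fun c => by
  have e : permute g (permute g⁻¹ c) = c := by rw [← permute_mul, mul_inv_cancel, permute_one]
  have h1 := h (permute g⁻¹ c)
  rw [e] at h1
  exact ⟨h1.1.symm, fun hc => (h1.2 (h1.1.1 hc)).symm⟩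

theorem permute_pos {g : Equiv.Perm (Fin 4 × Fin 4)} {c : Matrix (Fin 4) (Fin 4) ℕ}
    (h : ∀ j k, 0 < c j k) (j k : Fin 4) : 0 < permute g c j k := h _ _

theorem stabilizes_of_involution {g : Equiv.Perm (Fin 4 × Fin 4)} (hg : g * g = 1)
    (h : ∀ c, Admissible c → Admissible (permute g c) ∧
      H (permute g c) / (facProd (permute g c) : ℝ) = H c / (facProd c : ℝ)) :
    Stabilizes g := fun c => by
  refine ⟨⟨fun hc => ?_, fun hc => (h c hc).1⟩, fun hc => (h c hc).2⟩
  have := (h _ hc).1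
  rwa [← permute_mul, hg, permute_one] at this

theorem stabilizes_lineSwap (i : Fin 4) : Stabilizes (lineSwap i 3) := by
  refine stabilizes_of_involution ?_ ?_
  · revert i
    decide
  rintro c ⟨⟨a, b, hp, rfl⟩, hpos⟩
  refine ⟨⟨⟨_, _, hp.comp_left _, permute_lineSwap ..⟩, permute_pos hpos⟩, ?_⟩
  rw [permute_lineSwap, hp.quotient_eq, (hp.comp_left _).quotient_eq, signedSum_comp_left,
    facDenom_comp_left]

theorem stabilizes_colSwap : Stabilizes (colSwap 2 3) := by
  refine stabilizes_of_involution (by decide) ?_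
  rintro c ⟨⟨a, b, hp, rfl⟩, hpos⟩
  refine ⟨⟨⟨_, _, hp.swap_right, permute_colSwap⟩, permute_pos hpos⟩, ?_⟩
  rw [permute_colSwap, hp.quotient_eq, hp.swap_right.quotient_eq, signedSum_swap_right]
  rfl

/-- Positivity of the entries enters here: with strict inequalities the lowered parameters of
`rhoSum_contiguous_image` still satisfy `IsParam`. -/
theorem IsParam.lt_of_pos {a b : Fin 4 → ℤ} (hp : IsParam a b)
    (hpos : ∀ j k, 0 < cMatrix a b j k) :
    (∀ j, b 0 < a j) ∧ (∀ j, b 1 < a j) ∧ ∀ j, a j + 1 < b 3 := by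
  refine ⟨fun j => ?_, fun j => ?_, fun j => ?_⟩
  · have := hp.cMatrix_zero j ▸ hpos j 0
    omega
  · have := hp.cMatrix_one j ▸ hpos j 1
    omega
  · have := hp.cMatrix_three j ▸ hpos j 3
    omega

/-- Of the eight factorials in `facDenom`, four are replaced as in `signedSum_image`; the other
four, of c₂₁, c₄₁, c₁₂, c₃₂, are fixed by `𝔥`. -/
theorem IsParam.quotient_image {a b : Fin 4 → ℤ} (hp : IsParam a b)
    (hpos : ∀ j k, 0 < cMatrix a b j k) (hs : 0 ≤ hShift a b) :
    -signedSum (hLeft a b) (hRight a b) / facDenom (hLeft a b) (hRight a b) =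
      -signedSum a b / facDenom a b := by
  obtain ⟨n, hn⟩ := Int.eq_ofNat_of_zero_le hs
  obtain ⟨h0, h1, h3⟩ := hp.lt_of_pos hpos
  have key := signedSum_image n (a0 := a 0) (a1 := a 1) (a2 := a 2) (a3 := a 3) (b0 := b 0)
    (b1 := b 1) (b2 := b 2) (b3 := b 3) (by rwa [vec_eta, vec_eta]) hn (by rwa [vec_eta])
    (by rwa [vec_eta]) (h3 1) (h3 3)
  have bal := hp.balanced
  unfold hShift at hn
  have e1 : a 0 + n - b 0 = b 2 - a 2 - 1 := by omega
  have e2 : a 2 + n - b 0 = b 2 - a 0 - 1 := by omega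
  have e3 : a 1 - (b 1 + n) = b 3 - a 3 - 1 := by omega
  have e4 : a 3 - (b 1 + n) = b 3 - a 1 - 1 := by omega
  simp only [hLeft, hRight, hShift, hn, facDenom, Fin.prod_univ_four, Matrix.cons_val,
    add_sub_add_right_eq_sub, e1, e2, e3, e4]
  rw [vec_eta, vec_eta] at key
  rw [div_eq_div_iff (by simp [fac_ne_zero]) (by simp [fac_ne_zero])]
  linear_combination -(fac (a 1 - b 0) * fac (a 3 - b 0) * fac (a 0 - b 1) * fac (a 2 - b 1)) * key

theorem stabilizes_hPerm : Stabilizes hPerm := by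
  have inv : hPerm * hPerm = 1 := by decide
  refine stabilizes_of_involution inv ?_
  rintro c ⟨⟨a, b, hp, rfl⟩, hpos⟩
  refine ⟨⟨⟨_, _, hp.image, hp.permute_hPerm⟩, permute_pos hpos⟩, ?_⟩
  rcases le_total 0 (hShift a b) with hs | hs
  · rw [hp.permute_hPerm, hp.quotient_eq, hp.image.quotient_eq, hp.quotient_image hpos hs]
  · have hq := hp.image
    have key := hq.quotient_image (hp.permute_hPerm ▸ permute_pos hpos)
      (by rw [hShift_image]; omega)
    rw [← hq.quotient_eq, ← hq.image.quotient_eq, ← hq.permute_hPerm, ← hp.permute_hPerm,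
      ← permute_mul, inv, permute_one] at key
    exact key.symm

theorem stabilizes_of_mem {g : Equiv.Perm (Fin 4 × Fin 4)} (hg : g ∈ groupG) :
    Stabilizes g := by
  induction hg using Subgroup.closure_induction with
  | mem x hx =>
    rcases hx with rfl | rfl | rfl | rfl | rfl
    exacts [stabilizes_lineSwap 0, stabilizes_lineSwap 1, stabilizes_lineSwap 2,
      stabilizes_colSwap, stabilizes_hPerm]
  | one => exact fun c => ⟨Iff.rfl, fun _ => rfl⟩
  | mul x y _ _ hx hy => exact hx.mul hy
  | inv x _ hx => exact hx.inv

end ZetaThree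

theorem lemma9 (c : Matrix (Fin 4) (Fin 4) ℕ) (hc : ZetaThree.Admissible c)
    (g : Equiv.Perm (Fin 4 × Fin 4)) (hg : g ∈ ZetaThree.groupG) :
    ZetaThree.Admissible (ZetaThree.permute g c) ∧
      ZetaThree.H (ZetaThree.permute g c) / (ZetaThree.facProd (ZetaThree.permute g c) : ℝ) =
        ZetaThree.H c / (ZetaThree.facProd c : ℝ) := by
  have h := ZetaThree.stabilizes_of_mem hg c
  exact ⟨h.1.2 hc, h.2 hc⟩
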